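/- Let $\Gamma$ be the quiver with vertices $1,\dots,n$ and $a_{ij}\in\mathbb N$ arrows $X_{ij}^{(1)},\dots,X_{ij}^{(a_{ij})}$ from $i$ to $j$. Let $\mathbb F_q$ be a finite field and $\mathcal R$ a set of cyclic relations for $\Gamma$ over $\mathbb F_q$, i.e. each $R\in\mathcal R$ is an $\mathbb F_q$-linear combination of monomials $X_{i_0i_1}^{(k_1)}X_{i_1i_2}^{(k_2)}\cdots X_{i_{s-1}i_s}^{(k_s)}$ with $s\ge 1$ whose starting and ending points $i_0=i_s$ are all one vertex. For $\alpha\in\mathbb N^n$ and an extension field $K$ of $\mathbb F_q$, let $\mathrm{Rep}(\alpha,K)$ be the set of families $\sigma$ of matrices $\sigma(X_{ij}^{(k)})\in\mathrm{Mat}(\alpha_i\times\alpha_j,K)$; extend $\sigma$ to relations multiplicatively and linearly, and let $\mathrm{Rep}(\alpha,K)_{\mathcal R}$ be the set of those $\sigma$ for which $\sigma(R)$ is nilpotent for every $R\in\mathcal R$. For $e\ge 1$ put $r(\alpha,q^e)=|\mathrm{Rep}(\alpha,\mathbb F_{q^e})_{\mathcal R}|$, where $\mathbb F_{q^e}$ is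 any extension of $\mathbb F_q$ of degree $e$. For partitions $\lambda,\mu$ let $m_\lambda^{\underline s}$ be the number of parts of $\lambda$ equal to $s$, $\lambda'_i$ the number of parts of $\lambda$ that are at least $i$, and $$(|\lambda,\mu|)=\sum_{i\ge1}\lambda'_i\mu'_i-\sum_{s\ge1}m_\lambda^{\underline s}m_\mu^{\underline s}.$$ For a monic polynomial $f=a_0+a_1x+\dots+a_{d-1}x^{d-1}+x^d\in\mathbb F_q[x]$ let $c(f)$ be its companion matrix (ones just above the diagonal, last row $(-a_0,\dots,-a_{d-1})$, all other entries $0$), let $J_m(f)$ be the $m\times m$ block matrix with $c(f)$ on the diagonal, identity matrices of order $d$ just above it and zeros elsewhere, and let $J_\lambda(f)=J_{\lambda_1}(f)\oplus J_{\lambda_2}(f)\oplus\cdots$ for a partition $\lambda=(\lambda_1\ge\lambda_2\ge\cdots)$. **Theorem.** Let $\pi=(\pi_1,\dots,\pi_n)$ be an $n$-tuple of partitions, $f\in\mathbb F_q[x]$ a monic irreducible polynomial of degree $d$ with $f\ne x$, and $\alpha=d\,(|\pi_1|,\dots,|\pi_n|)$. Then $g=(J_{\pi_1}(f),\dots,J_{\pi_n}(f))$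 lies in $\mathrm{GL}(\alpha,\mathbb F_q)=\prod_i\mathrm{GL}(\alpha_i,\mathbb F_q)$. Let $X_g$ be the set of all $\sigma\in\mathrm{Rep}(\alpha,\mathbb F_q)$ with $g\sigma=\sigma$, where $(g\sigma)(X_{ij}^{(k)})=g_i^{-1}\sigma(X_{ij}^{(k)})g_j$. Then $$|X_g\cap\mathrm{Rep}(\alpha,\mathbb F_q)_{\mathcal R}|=q^{\,d\sum_{1\le i,j\le n}a_{ij}(|\pi_i,\pi_j|)}\prod_{s\ge1}r(d_\pi^{\,\underline s},q^d),$$ where $d_\pi^{\,\underline s}=(m_{\pi_1}^{\underline s},\dots,m_{\pi_n}^{\underline s})$; the factors with $s$ larger than all parts of $\pi_1,\dots,\pi_n$ are equal to $1$. In particular, if for every $\alpha\in\mathbb N^n$ there is a polynomial $r(\alpha,\cdot)\in\mathbb Q[t]$ with $|\mathrm{Rep}(\alpha,\mathbb F_{q^e})_{\mathcal R}|=r(\alpha,q^e)$ for all $e\ge1$, then the identity holds with the values of these polynomials at $q^d$. -/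

import Mathlib

open Polynomial

namespace NilpQuiver

section Quivers

/-! The quiver defined by `C = [a_ij]`: its vertices are `Fin n`, and its arrows from `i` to `j`
are `X_ij^(k)` with `k : Fin (C i j)`. -/

/-- Simple relations with given starting point and ending point: the monomials
`X_{i₀i₁}^{(k₁)} X_{i₁i₂}^{(k₂)} ⋯ X_{i_{s-1}i_s}^{(k_s)}`, `s ≥ 1`. -/
inductive SimpleRelation {n : ℕ} (C : Matrix (Fin n) (Fin n) ℕ) : Fin n → Fin n → Type
  | arrow {i j : Fin n} (k : Fin (C i j)) : SimpleRelation C i j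
  | mul {i j l : Fin n} (p : SimpleRelation C i j) (k : Fin (C j l)) : SimpleRelation C i l

/-- Cyclic relations over `F`: linear combinations over `F` of simple relations that all start
and end at the same vertex. -/
structure CyclicRelation {n : ℕ} (C : Matrix (Fin n) (Fin n) ℕ) (F : Type*) [Field F] where
  vertex : Fin n
  coeffs : SimpleRelation C vertex vertex →₀ F

/-- Representations over `K` whose matrix at an arrow `i → j` has rows indexed by `ι i` and
columns indexed by `ι j`. -/
def RepOn {n : ℕ} (C : Matrix (Fin n) (Fin n) ℕ) (ι : Fin n → Type*) (K : Type*) : Type _ :=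
  ∀ i j : Fin n, Fin (C i j) → Matrix (ι i) (ι j) K

/-- `Rep(α, K)`: representations of dimension `α` over `K`. -/
abbrev Rep {n : ℕ} (C : Matrix (Fin n) (Fin n) ℕ) (α : Fin n → ℕ) (K : Type*) : Type _ :=
  RepOn C (fun i => Fin (α i)) K

namespace RepOn

variable {n : ℕ} {C : Matrix (Fin n) (Fin n) ℕ} {ι : Fin n → Type*} [∀ i, Fintype (ι i)]
  {K : Type*} [Field K]

/-- The value of a representation on a simple relation: the product of the matrices of its
arrows, in the same order. -/
def evalSimple (σ : RepOn C ι K) {i j : Fin n} : SimpleRelation C i j → Matrix (ι i) (ι j) K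
  | .arrow k => σ _ _ k
  | .mul p k => evalSimple σ p * σ _ _ k

/-- `σ(R)`, where `K` is an extension field of the field `F` of coefficients of `R`. -/
noncomputable def eval {F : Type*} [Field F] [Algebra F K] (σ : RepOn C ι K)
    (R : CyclicRelation C F) : Matrix (ι R.vertex) (ι R.vertex) K :=
  R.coeffs.sum fun p c => c • σ.evalSimple p

variable [∀ i, DecidableEq (ι i)]

/-- `σ` respects all relations in `𝓡` nilpotently. -/
def RespectsNilpotently {F : Type*} [Field F] [Algebra F K] (σ : RepOn C ι K)
    (𝓡 : Set (CyclicRelation C F)) : Prop :=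
  ∀ R ∈ 𝓡, IsNilpotent (σ.eval R)

/-- `gσ`, where `(gσ)(X_ij^(k)) = g_i⁻¹ σ(X_ij^(k)) g_j`. -/
def act (g : ∀ i, GL (ι i) K) (σ : RepOn C ι K) : RepOn C ι K :=
  fun i j k => ((g i)⁻¹ : GL (ι i) K).val * σ i j k * (g j).val

end RepOn

/-- `Rep(α, K)_𝓡`: representations of dimension `α` over the extension field `K` of `F` that
respect all relations in `𝓡` nilpotently. -/
def nilRep {n : ℕ} {C : Matrix (Fin n) (Fin n) ℕ} {F : Type*} [Field F]
    (𝓡 : Set (CyclicRelation C F)) (α : Fin n → ℕ) (K : Type*) [Field K] [Algebra F K] :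
    Set (Rep C α K) :=
  {σ | σ.RespectsNilpotently 𝓡}

/-- `X_g`: the set of `σ` in `Rep(α, K)` with `gσ = σ`. -/
def fixedReps {n : ℕ} (C : Matrix (Fin n) (Fin n) ℕ) {α : Fin n → ℕ} {K : Type*} [Field K]
    (g : ∀ i, GL (Fin (α i)) K) : Set (Rep C α K) :=
  {σ | σ.act g = σ}

/-- `P` is the polynomial `r(α, ·)`: `|Rep(α, 𝔽_{q^e})_𝓡| = P(q^e)` for all `e ≥ 1`, where
`q = |F|` and `𝔽_{q^e}` is any extension field of `F` of degree `e`. -/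
def IsCountingPolynomial.{u} {n : ℕ} {C : Matrix (Fin n) (Fin n) ℕ} {F : Type u} [Field F]
    (𝓡 : Set (CyclicRelation C F)) (α : Fin n → ℕ) (P : ℚ[X]) : Prop :=
  ∀ e : ℕ, 1 ≤ e → ∀ (L : Type u) [Field L] [Algebra F L], Module.finrank F L = e →
    ((nilRep 𝓡 α L).ncard : ℚ) = P.eval ((Nat.card F : ℚ) ^ e)

end Quivers

section Partitions

/-- `m_λ^s`: the number of parts of `l` equal to `s`. -/
def mult {a : ℕ} (l : a.Partition) (s : ℕ) : ℕ := l.parts.count s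

/-- `λ'_i`: the number of parts of `l` that are at least `i`. -/
def conjPart {a : ℕ} (l : a.Partition) (i : ℕ) : ℕ := (l.parts.filter (i ≤ ·)).card

/-- `⟨λ, μ⟩ = ∑_{i ≥ 1} λ'_i μ'_i`, where `λ'_i = 0` for `i` greater than the weight `a`
of `λ`. -/
def innerProd {a b : ℕ} (l : a.Partition) (m : b.Partition) : ℕ :=
  ∑ i ∈ Finset.Icc 1 a, conjPart l i * conjPart m i

/-- `∑_{s ≥ 1} m_λ^s m_μ^s`, where `m_λ^s = 0` for `s` greater than the weight `a` of `λ`. -/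
def multProd {a b : ℕ} (l : a.Partition) (m : b.Partition) : ℕ :=
  ∑ s ∈ Finset.Icc 1 a, mult l s * mult m s

/-- `(|λ, μ|) = ⟨λ, μ⟩ - ∑_{s ≥ 1} m_λ^s m_μ^s`; the subtraction does not truncate, by
`multProd_le_innerProd`. -/
def redInnerProd {a b : ℕ} (l : a.Partition) (m : b.Partition) : ℕ :=
  innerProd l m - multProd l m

lemma mult_le_conjPart {a : ℕ} (l : a.Partition) (s : ℕ) : mult l s ≤ conjPart l s := by
  unfold mult conjPart
  rw [← Multiset.countP_eq_card_filter, Multiset.count]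
  rw [Multiset.countP_eq_card_filter, Multiset.countP_eq_card_filter]
  exact Multiset.card_le_card (Multiset.monotone_filter_right _ fun b h => h.le)

lemma multProd_le_innerProd {a b : ℕ} (l : a.Partition) (m : b.Partition) :
    multProd l m ≤ innerProd l m :=
  Finset.sum_le_sum fun s _ => Nat.mul_le_mul (mult_le_conjPart l s) (mult_le_conjPart m s)

/-- The parts of `l` in weakly decreasing order. -/
def partList {a : ℕ} (l : a.Partition) : List ℕ := l.parts.sort (· ≥ ·)

lemma sum_partList {a : ℕ} (l : a.Partition) (d : ℕ) :
    ∑ k : Fin (partList l).length, (partList l)[k] * d = d * a := by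
  have h : ∑ k : Fin (partList l).length, (partList l)[k] = a := by
    refine (Fin.sum_univ_fun_getElem (partList l) id).trans ?_
    rw [List.map_id, ← Multiset.sum_coe, partList, Multiset.sort_eq, l.parts_sum]
  rw [← Finset.sum_mul, h, mul_comm]

end Partitions

section JordanForms

variable {F : Type*} [Field F]

/-- The companion matrix `c(f)` of a monic polynomial `f`: ones just above the diagonal, and
the last row is `(-a_0, …, -a_{d-1})`. -/
def companion (f : F[X]) : Matrix (Fin f.natDegree) (Fin f.natDegree) F :=
  Matrix.of fun i j =>
    if i.val + 1 = f.natDegree then -f.coeff j.val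
    else if i.val + 1 = j.val then 1 else 0

/-- The Jordan block `J_m(f)`: an `m × m` block matrix, with `c(f)` on the diagonal and identity
matrices just above it. The index `(x, u)` is the position `u` within the block row `x`. -/
def jordanBlock (f : F[X]) (m : ℕ) :
    Matrix (Fin m × Fin f.natDegree) (Fin m × Fin f.natDegree) F :=
  Matrix.of fun x y =>
    if x.1 = y.1 then companion f x.2 y.2
    else if x.1.val + 1 = y.1.val then (1 : Matrix _ _ F) x.2 y.2 else 0

/-- Positions in a block diagonal matrix with blocks `J_{λ_1}(f), J_{λ_2}(f), …` are numbered
in lexicographic order. -/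
def jordanIndex {a : ℕ} (l : a.Partition) (d : ℕ) :
    ((k : Fin (partList l).length) × (Fin (partList l)[k] × Fin d)) ≃ Fin (d * a) :=
  (Equiv.sigmaCongrRight fun _ => finProdFinEquiv).trans
    (finSigmaFinEquiv.trans (finCongr (sum_partList l d)))

/-- `J_λ(f) = J_{λ_1}(f) ⊕ J_{λ_2}(f) ⊕ ⋯`, a square matrix of order `deg(f) |λ|`. -/
def jordanMatrix (f : F[X]) {a : ℕ} (l : a.Partition) :
    Matrix (Fin (f.natDegree * a)) (Fin (f.natDegree * a)) F :=
  Matrix.reindex (jordanIndex l f.natDegree) (jordanIndex l f.natDegree)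
    (Matrix.blockDiagonal' fun k : Fin (partList l).length => jordanBlock f (partList l)[k])

end JordanForms

end NilpQuiver

/-!
Let `K` be the extension of `F` of degree `d = deg f` and `θ ∈ K` a root of `f`. The centralizer
of the companion matrix of `f` in `Mat_d(F)` is a copy of `K`, in which the companion matrix is
`θ` (`exists_algHom_companion`). Read over `K`, the matrix `J_λ(f)` is the ordinary Jordan matrix
`θ + N_λ`, where `N_λ` is multiplication by `t` on `M_λ = ⨁ₖ K[t]/t^(λ_k)`. Since `x ↦ x ^ |K| ^ r`
is additive on commuting matrices, fixes `θ` and kills `N_λ` for large `r`, the scalar `θ` is a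
power of `J_λ(f)`. So the matrices that intertwine `J_λ(f)` and `J_μ(f)` are `K`-linear and
intertwine `N_λ` and `N_μ` (`blockMap_mul_eq_mul_blockMap_iff`): the representations in `X_g` are
the representations of the quiver in the `K[t]`-modules `M_{π_i}` and `K[t]`-linear maps.

A `K[t]`-linear map `M_λ → M_μ` is given by the images of the generators, where the image of the
`k`-th generator is any element killed by `t^(λ_k)`. For every `s`, the constant terms between
summands of the same length `s` form an `m_λ^s × m_μ^s` matrix over `K`. These matrices multiply
when maps are composed (`submatrix_firstBox_mul`), because a map `K[t]/t^s → K[t]/t^s` that factors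
through a summand of another length is not invertible. An endomorphism of `M_λ` for which all of
them vanish is strictly triangular for a suitable order of the basis, hence nilpotent; so an
endomorphism is nilpotent if and only if all of them are (`isNilpotent_iff_submatrix_firstBox`).
Hence the nilpotency condition on a representation in `X_g` only concerns its constant parts, which
are arbitrary representations over `K` of the dimensions `d_π^s`. The remaining coefficients are
free, and there are `∑ min(λ_k, μ_l) - ∑ m_λ^s m_μ^s = (|λ, μ|)` of them for each arrow
(`card_freeEntry`, `RepOn.ncard_commutesWithShift`).
-/

namespace NilpQuiver

/-! ### Intertwiners of nilpotent Jordan matrices -/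

section Intertwiners

open Matrix

variable {K : Type*} [Field K]

/-- The boxes of a family of rows of lengths `len k`: the basis of `⨁ₖ K[t]/t^(len k)`, in which
`⟨k, x⟩` stands for `t^x` in the `k`-th summand. -/
abbrev Boxes {κ : Type*} (len : κ → ℕ) : Type _ := (k : κ) × Fin (len k)

/-- Multiplication by `t` on `⨁ₖ K[t]/t^(len k)`, acting on row vectors from the right. -/
def shift (K : Type*) [Field K] {κ : Type*} [DecidableEq κ] (len : κ → ℕ) :
    Matrix (Boxes len) (Boxes len) K :=
  of fun a b => if a.1 = b.1 ∧ a.2.val + 1 = b.2.val then 1 else 0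

/-- The matrix of the `K[t]`-linear map `⨁ₖ K[t]/t^(len k) → ⨁ₗ K[t]/t^(len' l)` that maps the
generator of the `k`-th summand to `∑ₗ ∑_y b k l y • t^y`. -/
def toeplitz {κ κ' : Type*} (len : κ → ℕ) (len' : κ' → ℕ) (b : κ → κ' → ℕ → K) :
    Matrix (Boxes len) (Boxes len') K :=
  of fun p q => if p.2.val ≤ q.2.val then b p.1 q.1 (q.2.val - p.2.val) else 0

lemma height_add_le_of_pow_apply_ne_zero {P : Type*} [Fintype P] [DecidableEq P] {B : Matrix P P K}
    (h : P → ℕ) (hB : ∀ a b, B a b ≠ 0 → h a < h b) (r : ℕ) (a b : P) (hab : (B ^ r) a b ≠ 0) :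
    h a + r ≤ h b := by
  induction r generalizing b with
  | zero =>
    have : a = b := by
      by_contra hne
      exact hab (by simp [Matrix.one_apply_ne hne])
    simp [this]
  | succ r ih =>
    rw [pow_succ, Matrix.mul_apply] at hab
    obtain ⟨c, -, hc⟩ := Finset.exists_ne_zero_of_sum_ne_zero hab
    have h1 := ih c (left_ne_zero_of_mul hc)
    have h2 := hB c b (right_ne_zero_of_mul hc)
    omega

/-- A matrix is nilpotent when its nonzero entries strictly increase a height function. -/
lemma isNilpotent_of_height {P : Type*} [Fintype P] [DecidableEq P] {B : Matrix P P K}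
    (h : P → ℕ) (hB : ∀ a b, B a b ≠ 0 → h a < h b) : IsNilpotent B := by
  refine ⟨Finset.univ.sup h + 1, ?_⟩
  ext a b
  by_contra hab
  have h1 := height_add_le_of_pow_apply_ne_zero h hB _ a b hab
  have h2 : h b ≤ Finset.univ.sup h := Finset.le_sup (Finset.mem_univ b)
  omega

variable {κ κ' κ'' : Type*} {len : κ → ℕ} {len' : κ' → ℕ} {len'' : κ'' → ℕ}

/-- The boxes in column zero of the rows of length `s`, where `e` numbers these rows. -/
def firstBox (hlen : ∀ k, 0 < len k) {s : ℕ} {ρ : Type*} (e : ρ ≃ {k // len k = s}) (p : ρ) :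
    Boxes len :=
  ⟨(e p).1, ⟨0, hlen _⟩⟩

lemma firstBox_injective (hlen : ∀ k, 0 < len k) {s : ℕ} {ρ : Type*} (e : ρ ≃ {k // len k = s}) :
    Function.Injective (firstBox hlen e) := by
  intro p q h
  exact e.injective (Subtype.ext (congrArg Sigma.fst h))

lemma firstBox_symm_apply (hlen : ∀ k, 0 < len k) {s : ℕ} {ρ : Type*}
    (e : ρ ≃ {k // len k = s}) (k : κ) (h : len k = s) :
    firstBox hlen e (e.symm ⟨k, h⟩) = ⟨k, ⟨0, hlen k⟩⟩ := by
  have h1 : ∀ l (hl : 0 < len l), l = k → (⟨l, ⟨0, hl⟩⟩ : Boxes len) = ⟨k, ⟨0, hlen k⟩⟩ := by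
    rintro l hl rfl
    rfl
  exact h1 _ _ (by simp)

variable [Fintype κ] [DecidableEq κ] [Fintype κ'] [DecidableEq κ']
  [Fintype κ''] [DecidableEq κ'']

lemma shift_mul_apply {β : Type*} (B : Matrix (Boxes len) β K) (k : κ) (x : Fin (len k)) (b : β) :
    (shift K len * B) ⟨k, x⟩ b =
      if h : x.val + 1 < len k then B ⟨k, ⟨x.val + 1, h⟩⟩ b else 0 := by
  rw [Matrix.mul_apply]
  split_ifs with h
  · rw [Finset.sum_eq_single ⟨k, ⟨x.val + 1, h⟩⟩]
    · simp [shift]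
    · rintro ⟨l, y⟩ - hne
      have : ¬ (k = l ∧ x.val + 1 = y.val) := by
        rintro ⟨rfl, hy⟩
        exact hne (by simp [hy])
      simp [shift, this]
    · simp
  · refine Finset.sum_eq_zero ?_
    rintro ⟨l, y⟩ -
    have : ¬ (k = l ∧ x.val + 1 = y.val) := by
      rintro ⟨rfl, hy⟩
      exact h (hy ▸ y.2)
    simp [shift, this]

lemma mul_shift_apply {β : Type*} (B : Matrix β (Boxes len) K) (a : β) (l : κ) (y : Fin (len l)) :
    (B * shift K len) a ⟨l, y⟩ =
      if 0 < y.val then B a ⟨l, ⟨y.val - 1, by omega⟩⟩ else 0 := by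
  rw [Matrix.mul_apply]
  split_ifs with h
  · rw [Finset.sum_eq_single ⟨l, ⟨y.val - 1, by omega⟩⟩]
    · simp [shift, Nat.sub_add_cancel h]
    · rintro ⟨k, x⟩ - hne
      have : ¬ (k = l ∧ x.val + 1 = y.val) := by
        rintro ⟨rfl, hy⟩
        exact hne (by simp [← hy])
      simp [shift, this]
    · simp
  · refine Finset.sum_eq_zero ?_
    rintro ⟨k, x⟩ -
    have : ¬ (k = l ∧ x.val + 1 = y.val) := by
      rintro ⟨rfl, hy⟩
      omega
    simp [shift, this]

lemma isNilpotent_shift : IsNilpotent (shift K len) := by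
  refine isNilpotent_of_height (fun a => a.2.val) fun a b hab => ?_
  by_contra h
  refine hab ?_
  have : ¬ (a.1 = b.1 ∧ a.2.val + 1 = b.2.val) := by omega
  simp [shift, this]

/-- The image of a generator of `K[t]/t^(len k)` has to be annihilated by `t^(len k)`; apart from
this it is arbitrary. -/
lemma shift_mul_toeplitz (b : κ → κ' → ℕ → K)
    (hb : ∀ k l y, y < len' l → b k l y ≠ 0 → len' l ≤ y + len k) :
    shift K len * toeplitz len len' b = toeplitz len len' b * shift K len' := by
  ext ⟨k, x⟩ ⟨l, y⟩
  rw [shift_mul_apply, mul_shift_apply]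
  simp only [toeplitz, of_apply]
  split_ifs with h1 h2 h3 h4 h5 h6 h7
  all_goals first
    | omega
    | rfl
    | skip
  · congr 1; omega
  · by_contra hne
    have := hb k l _ (by omega) (Ne.symm hne)
    omega

variable {B : Matrix (Boxes len) (Boxes len') K}

section

variable (hB : shift K len * B = B * shift K len')
include hB

lemma apply_add_one_eq (k : κ) (l : κ') (x y : ℕ) (hx : x + 1 < len k) (hy : y + 1 < len' l) :
    B ⟨k, ⟨x + 1, hx⟩⟩ ⟨l, ⟨y + 1, hy⟩⟩ = B ⟨k, ⟨x, by omega⟩⟩ ⟨l, ⟨y, by omega⟩⟩ := by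
  have := congrFun (congrFun hB ⟨k, ⟨x, by omega⟩⟩) ⟨l, ⟨y + 1, hy⟩⟩
  rw [shift_mul_apply, mul_shift_apply] at this
  simpa [hx] using this

lemma apply_add_eq (k : κ) (l : κ') (x y t : ℕ) (hx : x + t < len k) (hy : y + t < len' l) :
    B ⟨k, ⟨x + t, hx⟩⟩ ⟨l, ⟨y + t, hy⟩⟩ = B ⟨k, ⟨x, by omega⟩⟩ ⟨l, ⟨y, by omega⟩⟩ := by
  induction t with
  | zero => rfl
  | succ t ih => exact (apply_add_one_eq hB k l (x + t) (y + t) hx hy).trans (ih _ _)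

lemma apply_eq_zero_of_lt (k : κ) (l : κ') (x : Fin (len k)) (y : Fin (len' l)) (h : y < x.val) :
    B ⟨k, x⟩ ⟨l, y⟩ = 0 := by
  obtain ⟨x, hx⟩ := x
  obtain ⟨y, hy⟩ := y
  obtain ⟨z, rfl⟩ : ∃ z, x = (z + 1) + y := ⟨x - 1 - y, by simp at h; omega⟩
  have h1 := apply_add_eq hB k l (z + 1) 0 y hx (by omega)
  have h2 := congrFun (congrFun hB ⟨k, ⟨z, by omega⟩⟩) ⟨l, ⟨0, by omega⟩⟩
  rw [shift_mul_apply, mul_shift_apply, dif_pos (by simp; omega), if_neg (by simp)] at h2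
  simp only [zero_add] at h1
  exact h1.trans h2

lemma apply_eq_of_le (k : κ) (l : κ') (x : Fin (len k)) (y : Fin (len' l)) (h : x.val ≤ y) :
    B ⟨k, x⟩ ⟨l, y⟩ = B ⟨k, ⟨0, by omega⟩⟩ ⟨l, ⟨y - x, by omega⟩⟩ := by
  have h1 := apply_add_eq hB k l 0 (y - x) x (by omega) (by omega)
  rw [← h1]
  congr 3 <;> simp [Fin.ext_iff]
  omega

lemma le_of_apply_zero_ne_zero (k : κ) (l : κ') (hk : 0 < len k) (y : Fin (len' l))
    (h : B ⟨k, ⟨0, hk⟩⟩ ⟨l, y⟩ ≠ 0) : len' l ≤ y + len k := by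
  by_contra! hlt
  have h1 := apply_add_eq hB k l 0 y (len k - 1) (by omega) (by omega)
  have h2 := congrFun (congrFun hB ⟨k, ⟨len k - 1, by omega⟩⟩) ⟨l, ⟨y + len k, hlt⟩⟩
  rw [shift_mul_apply, mul_shift_apply, dif_neg (by simp; omega), if_pos (by simp; omega)] at h2
  refine h (h1.symm.trans (Eq.trans ?_ h2.symm))
  congr 3 <;> simp
  omega

lemma ext_of_apply_zero (hlen : ∀ k, 0 < len k) {B' : Matrix (Boxes len) (Boxes len') K}
    (hB' : shift K len * B' = B' * shift K len')
    (h : ∀ k l y, len' l ≤ y.val + len k → B ⟨k, ⟨0, hlen k⟩⟩ ⟨l, y⟩ = B' ⟨k, ⟨0, hlen k⟩⟩ ⟨l, y⟩) :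
    B = B' := by
  have h' : ∀ k l y, B ⟨k, ⟨0, hlen k⟩⟩ ⟨l, y⟩ = B' ⟨k, ⟨0, hlen k⟩⟩ ⟨l, y⟩ := by
    intro k l y
    by_cases hy : len' l ≤ y.val + len k
    · exact h k l y hy
    · rw [not_imp_comm.1 (le_of_apply_zero_ne_zero hB k l (hlen k) y) hy,
        not_imp_comm.1 (le_of_apply_zero_ne_zero hB' k l (hlen k) y) hy]
  ext ⟨k, x⟩ ⟨l, y⟩
  rcases lt_or_ge y.val x.val with hxy | hxy
  · rw [apply_eq_zero_of_lt hB k l x y hxy, apply_eq_zero_of_lt hB' k l x y hxy]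
  · rw [apply_eq_of_le hB k l x y hxy, apply_eq_of_le hB' k l x y hxy, h']

end

/-- Between rows of the same length `s`, the constant term of a composition is the composition of
the constant terms: a map from a row of length `s` to itself that factors through a row of
another length is not an isomorphism. -/
lemma submatrix_firstBox_mul {s : ℕ} {ρ ρ' ρ'' : Type*} [Fintype ρ']
    (hlen : ∀ k, 0 < len k) (hlen' : ∀ k, 0 < len' k) (hlen'' : ∀ k, 0 < len'' k)
    (e : ρ ≃ {k // len k = s}) (e' : ρ' ≃ {k // len' k = s}) (e'' : ρ'' ≃ {k // len'' k = s})
    (hB : shift K len * B = B * shift K len') {B' : Matrix (Boxes len') (Boxes len'') K}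
    (hB' : shift K len' * B' = B' * shift K len'') :
    (B * B').submatrix (firstBox hlen e) (firstBox hlen'' e'') =
      B.submatrix (firstBox hlen e) (firstBox hlen' e') *
        B'.submatrix (firstBox hlen' e') (firstBox hlen'' e'') := by
  ext p q
  rw [submatrix_apply, Matrix.mul_apply, Matrix.mul_apply]
  symm
  refine Fintype.sum_of_injective (firstBox hlen' e') (firstBox_injective hlen' e') _ _ ?_
    fun _ => rfl
  rintro ⟨l, y⟩ hy
  by_contra hne
  have h1 := left_ne_zero_of_mul hne
  have h2 := right_ne_zero_of_mul hne
  have hy0 : y.val = 0 := by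
    by_contra h0
    exact h2 (apply_eq_zero_of_lt hB' _ _ _ _ (Nat.pos_of_ne_zero h0))
  obtain rfl : y = ⟨0, hlen' l⟩ := Fin.ext hy0
  have h3 := le_of_apply_zero_ne_zero hB _ _ (hlen _) _ h1
  have h4 := le_of_apply_zero_ne_zero hB' _ _ (hlen' _) _ h2
  have h5 := (e p).2
  have h6 := (e'' q).2
  simp only [zero_add] at h3 h4
  have h7 : len' l = s := le_antisymm (h3.trans_eq h5) (h6.symm.trans_le h4)
  refine hy ⟨e'.symm ⟨l, h7⟩, ?_⟩
  exact firstBox_symm_apply hlen' e' l h7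

lemma submatrix_firstBox_pow {s : ℕ} {ρ : Type*} [Fintype ρ] [DecidableEq ρ]
    (hlen : ∀ k, 0 < len k) (e : ρ ≃ {k // len k = s}) {B : Matrix (Boxes len) (Boxes len) K}
    (hB : Commute (shift K len) B) (r : ℕ) :
    (B ^ r).submatrix (firstBox hlen e) (firstBox hlen e) =
      (B.submatrix (firstBox hlen e) (firstBox hlen e)) ^ r := by
  induction r with
  | zero => simp [submatrix_one _ (firstBox_injective hlen e)]
  | succ r ih =>
    rw [pow_succ, pow_succ, submatrix_firstBox_mul hlen hlen hlen e e e (hB.pow_right r) hB, ih]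

/-- The endomorphisms of `⨁ₖ K[t]/t^(len k)` with vanishing constant terms between summands of the
same length form a nil ideal. -/
lemma isNilpotent_of_submatrix_firstBox_eq_zero (hlen : ∀ k, 0 < len k)
    {B : Matrix (Boxes len) (Boxes len) K} (hB : Commute (shift K len) B)
    (h : ∀ k l, len k = len l → B ⟨k, ⟨0, hlen k⟩⟩ ⟨l, ⟨0, hlen l⟩⟩ = 0) : IsNilpotent B := by
  -- Such a `B` raises the power of `t`, or keeps it and passes to a shorter row.
  set M := Finset.univ.sup len with hM
  have hle : ∀ k, len k ≤ M := fun k => Finset.le_sup (Finset.mem_univ k)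
  refine isNilpotent_of_height (fun a => a.2.val * (M + 1) + (M - len a.1)) ?_
  rintro ⟨k, x⟩ ⟨l, y⟩ hne
  have hxy : x.val ≤ y.val := by
    by_contra hlt
    exact hne (apply_eq_zero_of_lt hB k l x y (by omega))
  have hk := hle k
  have hl := hle l
  have hk' := hlen k
  have hl' := hlen l
  simp only
  rcases hxy.eq_or_lt with heq | hlt
  · rw [apply_eq_of_le hB k l x y hxy] at hne
    have h1 := le_of_apply_zero_ne_zero hB k l _ _ hne
    have h2 : len k ≠ len l := fun hkl => hne (by simpa [heq] using h k l hkl)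
    simp only [heq, tsub_self, zero_add] at h1
    rw [heq]
    omega
  · have : (x.val + 1) * (M + 1) ≤ y.val * (M + 1) := Nat.mul_le_mul_right _ hlt
    rw [add_mul, one_mul] at this
    omega

lemma isNilpotent_iff_submatrix_firstBox (hlen : ∀ k, 0 < len k) {ρ : ℕ → Type*}
    [∀ s, Fintype (ρ s)] [∀ s, DecidableEq (ρ s)] (e : ∀ s, ρ s ≃ {k // len k = s})
    {N : ℕ} (hN : ∀ k, len k ≤ N)
    {B : Matrix (Boxes len) (Boxes len) K} (hB : Commute (shift K len) B) :
    IsNilpotent B ↔ ∀ s ∈ Finset.Icc 1 N,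
      IsNilpotent (B.submatrix (firstBox hlen (e s)) (firstBox hlen (e s))) := by
  constructor
  · rintro ⟨r, hr⟩ s -
    exact ⟨r, by rw [← submatrix_firstBox_pow hlen (e s) hB, hr, submatrix_zero]; rfl⟩
  · intro h
    choose! r hr using h
    refine (isNilpotent_of_submatrix_firstBox_eq_zero hlen
      (hB.pow_right ((Finset.Icc 1 N).sup r)) fun k l hkl => ?_).of_pow
    have hs : len k ∈ Finset.Icc 1 N := Finset.mem_Icc.2 ⟨hlen k, hN k⟩
    have h1 := submatrix_firstBox_pow hlen (e (len k)) hB ((Finset.Icc 1 N).sup r)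
    rw [pow_eq_zero_of_le (Finset.le_sup hs) (hr _ hs)] at h1
    have h2 := congrFun (congrFun h1 ((e (len k)).symm ⟨k, rfl⟩)) ((e (len k)).symm ⟨l, hkl.symm⟩)
    simpa only [submatrix_apply, firstBox_symm_apply, Matrix.zero_apply] using h2

end Intertwiners
/-! ### The centralizer of a companion matrix -/

section Companion

variable {F : Type*} [Field F] {f : F[X]}

lemma companion_pow_zero (hd : 0 < f.natDegree) (i : ℕ) (hi : i < f.natDegree)
    (j : Fin f.natDegree) :
    (companion f ^ i) ⟨0, hd⟩ j = if i = j.val then 1 else 0 := by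
  induction i generalizing j with
  | zero => simp [Matrix.one_apply, Fin.ext_iff]
  | succ i ih =>
    rw [pow_succ, Matrix.mul_apply, Finset.sum_eq_single ⟨i, by omega⟩]
    · rw [ih (by omega)]
      simp [companion, hi.ne]
    · intro k _ hk
      rw [ih (by omega), if_neg (fun h => hk (Fin.ext h.symm)), zero_mul]
    · simp

/-- The first basis row vector is cyclic for the companion matrix, so a matrix that commutes with
the companion matrix is determined by its first row. -/
lemma ext_of_commute_companion (hd : 0 < f.natDegree)
    {B B' : Matrix (Fin f.natDegree) (Fin f.natDegree) F}
    (hB : Commute (companion f) B) (hB' : Commute (companion f) B')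
    (h : ∀ j, B ⟨0, hd⟩ j = B' ⟨0, hd⟩ j) : B = B' := by
  have row : ∀ {D : Matrix (Fin f.natDegree) (Fin f.natDegree) F}, Commute (companion f) D →
      ∀ i j, D i j = ∑ k, D ⟨0, hd⟩ k * (companion f ^ i.val) k j := by
    intro D hD i j
    rw [← Matrix.mul_apply, ← (hD.pow_left i.val).eq, Matrix.mul_apply, Finset.sum_eq_single i]
    · rw [companion_pow_zero hd i.val i.2, if_pos rfl, one_mul]
    · intro k _ hk
      rw [companion_pow_zero hd i.val i.2, if_neg (fun h => hk (Fin.ext h.symm)), zero_mul]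
    · simp
  ext i j
  rw [row hB, row hB']
  simp_rw [h]

lemma commute_aeval_companion (p : F[X]) : Commute (companion f) (aeval (companion f) p) := by
  have h : Commute (aeval (companion f) (X : F[X])) (aeval (companion f) p) :=
    (Commute.all X p).map (aeval (companion f))
  rwa [aeval_X] at h

lemma aeval_companion_self (hf : f.Monic) (hd : 0 < f.natDegree) :
    aeval (companion f) f = 0 := by
  refine ext_of_commute_companion hd (commute_aeval_companion f) (Commute.zero_right _) fun j => ?_
  rw [aeval_eq_sum_range, Finset.sum_range_succ, Matrix.add_apply, Matrix.sum_apply,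
    Finset.sum_eq_single j.val, Matrix.smul_apply, companion_pow_zero hd _ j.2, if_pos rfl,
    hf.coeff_natDegree, one_smul]
  · have h1 : companion f ^ f.natDegree = companion f ^ (f.natDegree - 1) * companion f := by
      rw [← pow_succ, Nat.sub_add_cancel hd]
    rw [h1, Matrix.mul_apply, Finset.sum_eq_single ⟨f.natDegree - 1, by omega⟩,
      companion_pow_zero hd _ (by omega), if_pos rfl]
    · simp [companion, Nat.sub_add_cancel hd]
    · intro k _ hk
      rw [companion_pow_zero hd _ (by omega), if_neg (fun h => hk (Fin.ext h.symm)), zero_mul]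
    · simp
  · intro i hi hij
    rw [Matrix.smul_apply, companion_pow_zero hd _ (Finset.mem_range.1 hi), if_neg hij, smul_zero]
  · simp

lemma exists_aeval_companion_eq (hd : 0 < f.natDegree)
    {B : Matrix (Fin f.natDegree) (Fin f.natDegree) F} (hB : Commute (companion f) B) :
    ∃ p : F[X], aeval (companion f) p = B := by
  refine ⟨∑ i : Fin f.natDegree, C (B ⟨0, hd⟩ i) * X ^ i.val,
    ext_of_commute_companion hd (commute_aeval_companion _) hB fun j => ?_⟩
  simp only [map_sum, map_mul, aeval_C, map_pow, aeval_X, Matrix.sum_apply,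
    ← Algebra.smul_def, Matrix.smul_apply]
  rw [Finset.sum_eq_single j]
  · rw [companion_pow_zero hd _ j.2, if_pos rfl, smul_eq_mul, mul_one]
  · intro i _ hi
    rw [companion_pow_zero hd _ i.2, if_neg (fun h => hi (Fin.ext h)), smul_zero]
  · simp

/-- The centralizer of the companion matrix of `f` is a copy of the extension field of
degree `deg f`, in which the companion matrix is a root of `f`. -/
lemma exists_algHom_companion [Finite F] (hf : f.Monic) (hirr : Irreducible f)
    {K : Type*} [Field K] [Algebra F K] (hK : Module.finrank F K = f.natDegree) :
    ∃ (φ : K →ₐ[F] Matrix (Fin f.natDegree) (Fin f.natDegree) F) (θ : K),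
      φ θ = companion f ∧ aeval θ f = 0 ∧ ∀ B, Commute (companion f) B → ∃ b, φ b = B := by
  have hd : 0 < f.natDegree := hirr.natDegree_pos
  have : Fact (Irreducible f) := ⟨hirr⟩
  have hfin : Module.finrank F (AdjoinRoot f) = f.natDegree :=
    (AdjoinRoot.powerBasis hf.ne_zero).finrank
  have : Module.Finite F K := Module.finite_of_finrank_pos (by omega)
  have : Module.Finite F (AdjoinRoot f) := Module.finite_of_finrank_pos (by omega)
  have : Finite (AdjoinRoot f) := Module.finite_of_finite F
  obtain ⟨ψ⟩ := FiniteField.nonempty_algHom_of_finrank_dvd (F := F) (K := K) (L := AdjoinRoot f)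
    (by rw [hK, hfin])
  have hψ : Function.Surjective ψ :=
    (LinearMap.injective_iff_surjective_of_finrank_eq_finrank (f := ψ.toLinearMap)
      (hK.trans hfin.symm)).1 ψ.injective
  let φ : AdjoinRoot f →ₐ[F] Matrix (Fin f.natDegree) (Fin f.natDegree) F :=
    Ideal.Quotient.liftₐ (Ideal.span {f}) (aeval (companion f)) fun p hp => by
      obtain ⟨r, rfl⟩ := Ideal.mem_span_singleton.1 hp
      rw [map_mul, aeval_companion_self hf hd, zero_mul]
  have hφ : ∀ p : F[X], φ (AdjoinRoot.mk f p) = aeval (companion f) p := fun _ => rfl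
  obtain ⟨θ, hθ⟩ := hψ (AdjoinRoot.root f)
  refine ⟨φ.comp ψ, θ, ?_, (RingHomClass.toRingHom ψ).injective ?_, fun B hB => ?_⟩
  · rw [AlgHom.comp_apply, hθ, ← AdjoinRoot.mk_X, hφ, aeval_X]
  · change ψ (aeval θ f) = ψ 0
    rw [← aeval_algHom_apply, hθ, map_zero, AdjoinRoot.aeval_eq, AdjoinRoot.mk_self]
  · obtain ⟨p, rfl⟩ := exists_aeval_companion_eq hd hB
    obtain ⟨b, hb⟩ := hψ (AdjoinRoot.mk f p)
    exact ⟨b, by rw [AlgHom.comp_apply, hb, hφ]⟩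

lemma ne_zero_of_aeval_eq_zero (hf : f.Monic) (hirr : Irreducible f) (hX : f ≠ X)
    {K : Type*} [Field K] [Algebra F K] {θ : K} (hθ : aeval θ f = 0) : θ ≠ 0 := by
  rintro rfl
  have h0 : f.coeff 0 = 0 := by
    have h1 : algebraMap F K (f.coeff 0) = 0 := by
      rw [coeff_zero_eq_aeval_zero, ← aeval_algebraMap_apply, map_zero, hθ]
    exact (map_eq_zero _).1 h1
  have hdvd : (X : F[X]) ∣ f := X_dvd_iff.2 h0
  exact hX (eq_of_monic_of_associated hf monic_X
    (irreducible_X.associated_of_dvd hirr hdvd).symm)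

end Companion

/-! ### Restriction of scalars for matrices -/

section BlockMap

variable {F K V : Type*} [Field F] [Field K] [Algebra F K] [Fintype V] [DecidableEq V]
  (φ : K →ₐ[F] Matrix V V F)
  {ι ι' ι'' P P' P'' : Type*} (ε : ι ≃ P × V) (ε' : ι' ≃ P' × V) (ε'' : ι'' ≃ P'' × V)

/-- The block matrix over `F` obtained from a matrix over `K` by applying `φ` to its entries. -/
def blockMap (B : Matrix P P' K) : Matrix ι ι' F :=
  Matrix.of fun a b => φ (B (ε a).1 (ε' b).1) (ε a).2 (ε' b).2

lemma blockMap_mul [Fintype ι'] [Fintype P'] (B : Matrix P P' K) (B' : Matrix P' P'' K) :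
    blockMap φ ε ε'' (B * B') = blockMap φ ε ε' B * blockMap φ ε' ε'' B' := by
  ext a b
  rw [Matrix.mul_apply, ← Equiv.sum_comp ε'.symm, Fintype.sum_prod_type]
  simp [blockMap, Matrix.mul_apply, Matrix.sum_apply]

lemma blockMap_add (B B' : Matrix P P' K) :
    blockMap φ ε ε' (B + B') = blockMap φ ε ε' B + blockMap φ ε ε' B' := by
  ext a b
  simp [blockMap]

lemma blockMap_zero : blockMap φ ε ε' 0 = 0 := by
  ext a b
  simp [blockMap]

lemma blockMap_one [DecidableEq ι] [DecidableEq P] : blockMap φ ε ε 1 = 1 := by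
  ext a b
  have hab : a = b ↔ (ε a).1 = (ε b).1 ∧ (ε a).2 = (ε b).2 := by
    rw [← Prod.ext_iff, ε.apply_eq_iff_eq]
  by_cases h : (ε a).1 = (ε b).1
  · simp [blockMap, h, Matrix.one_apply, hab]
  · simp [blockMap, h, Matrix.one_apply, hab]

lemma blockMap_injective [Nonempty V] : Function.Injective (blockMap φ ε ε') := by
  intro B B' h
  ext p p'
  refine φ.toRingHom.injective ?_
  ext u v
  simpa [blockMap] using congrFun (congrFun h (ε.symm (p, u))) (ε'.symm (p', v))

/-- `blockMap` on square matrices, as a ring homomorphism. -/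
def blockRingHom [Fintype ι] [DecidableEq ι] [Fintype P] [DecidableEq P] :
    Matrix P P K →+* Matrix ι ι F where
  toFun := blockMap φ ε ε
  map_one' := blockMap_one φ ε
  map_mul' := blockMap_mul φ ε ε ε
  map_zero' := blockMap_zero φ ε ε
  map_add' := blockMap_add φ ε ε

lemma isNilpotent_blockMap [Nonempty V] [Fintype ι] [DecidableEq ι] [Fintype P] [DecidableEq P]
    {B : Matrix P P K} : IsNilpotent (blockMap φ ε ε B) ↔ IsNilpotent B :=
  IsNilpotent.map_iff (f := blockRingHom φ ε) (blockMap_injective φ ε ε)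

/-- A matrix over `F` is `K`-linear as soon as it commutes with a scalar whose image under `φ` has
centralizer `φ(K)`. -/
lemma exists_blockMap_eq [Fintype ι] [Fintype ι'] [Fintype P] [DecidableEq P]
    [Fintype P'] [DecidableEq P'] {θ : K}
    (hφ : ∀ M, Commute (φ θ) M → ∃ b, φ b = M) {A : Matrix ι ι' F}
    (hA : blockMap φ ε ε (Matrix.scalar P θ) * A = A * blockMap φ ε' ε' (Matrix.scalar P' θ)) :
    ∃ B, blockMap φ ε ε' B = A := by
  have h : ∀ p p', Commute (φ θ) (Matrix.of fun u v => A (ε.symm (p, u)) (ε'.symm (p', v))) := by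
    intro p p'
    ext u v
    have h1 := congrFun (congrFun hA (ε.symm (p, u))) (ε'.symm (p', v))
    rw [Matrix.mul_apply, Matrix.mul_apply, ← Equiv.sum_comp ε.symm, ← Equiv.sum_comp ε'.symm,
      Fintype.sum_prod_type, Fintype.sum_prod_type] at h1
    simp only [blockMap, Matrix.of_apply, Equiv.apply_symm_apply, Matrix.scalar_apply] at h1
    rw [Finset.sum_eq_single p, Finset.sum_eq_single p'] at h1
    · simpa [Matrix.mul_apply] using h1
    · intro r _ hr
      simp [Matrix.diagonal_apply_ne _ hr]
    · simp
    · intro r _ hr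
      simp [Matrix.diagonal_apply_ne' _ hr]
    · simp
  choose B hB using fun p p' => hφ _ (h p p')
  refine ⟨Matrix.of B, ?_⟩
  ext a b
  simp [blockMap, hB]

end BlockMap

/-! ### The Jordan decomposition of the Jordan form -/

section Jordan

lemma scalar_add_shift_pow {K : Type*} [Field K] [Fintype K] {κ : Type*} [Fintype κ]
    [DecidableEq κ] {len : κ → ℕ} (θ : K) {r : ℕ} (hr : shift K len ^ r = 0) :
    (Matrix.scalar (Boxes len) θ + shift K len) ^ Fintype.card K ^ r =
      Matrix.scalar (Boxes len) θ := by
  rcases isEmpty_or_nonempty (Boxes len) with hP | hP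
  · exact Subsingleton.elim _ _
  obtain ⟨p, hchar, t, hp, hcard⟩ := FiniteField.card' K
  have : Fact p.Prime := ⟨hp⟩
  have h1 : Fintype.card K ^ r = p ^ (t * r) := by rw [hcard, pow_mul]
  rw [h1, add_pow_char_pow_of_commute _ _ (Matrix.scalar_commute θ (Commute.all θ) _), ← h1,
    ← map_pow, FiniteField.pow_card_pow,
    pow_eq_zero_of_le (Nat.lt_pow_self Fintype.one_lt_card).le hr, add_zero]

lemma pow_mul_eq_mul_pow {R : Type*} [Semiring R] {ι ι' : Type*} [Fintype ι] [DecidableEq ι]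
    [Fintype ι'] [DecidableEq ι'] {M : Matrix ι ι R} {M' : Matrix ι' ι' R} {A : Matrix ι ι' R}
    (h : M * A = A * M') (r : ℕ) : M ^ r * A = A * M' ^ r := by
  induction r with
  | zero => simp
  | succ r ih => rw [pow_succ, Matrix.mul_assoc, h, ← Matrix.mul_assoc, ih, Matrix.mul_assoc,
      ← pow_succ]

variable {F K V : Type*} [Field F] [Field K] [Finite K] [Algebra F K] [Fintype V] [DecidableEq V]
  [Nonempty V] (φ : K →ₐ[F] Matrix V V F)
  {ι ι' κ κ' : Type*} [Fintype ι] [DecidableEq ι] [Fintype ι'] [DecidableEq ι']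
  [Fintype κ] [DecidableEq κ] [Fintype κ'] [DecidableEq κ'] {len : κ → ℕ} {len' : κ' → ℕ}
  (ε : ι ≃ Boxes len × V) (ε' : ι' ≃ Boxes len' × V) {θ : K}

/-- The matrices that intertwine two Jordan forms with eigenvalue `θ ∈ K` are `K`-linear and
intertwine the nilpotent parts: a common power of both Jordan forms is the scalar `θ`. -/
lemma blockMap_mul_eq_mul_blockMap_iff (hφ : ∀ M, Commute (φ θ) M → ∃ b, φ b = M)
    {A : Matrix ι ι' F} :
    blockMap φ ε ε (Matrix.scalar _ θ + shift K len) * A =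
        A * blockMap φ ε' ε' (Matrix.scalar _ θ + shift K len') ↔
      ∃ B, shift K len * B = B * shift K len' ∧ blockMap φ ε ε' B = A := by
  have hscalar : ∀ B : Matrix (Boxes len) (Boxes len') K,
      Matrix.scalar (Boxes len) θ * B = B * Matrix.scalar (Boxes len') θ := by
    intro B
    ext a b
    rw [Matrix.scalar_apply, Matrix.scalar_apply, Matrix.diagonal_mul, Matrix.mul_diagonal, mul_comm]
  constructor
  · intro h
    have := Fintype.ofFinite K
    obtain ⟨r, hr⟩ := isNilpotent_shift (K := K) (len := len)
    obtain ⟨r', hr'⟩ := isNilpotent_shift (K := K) (len := len')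
    have h1 := pow_mul_eq_mul_pow h (Fintype.card K ^ (max r r'))
    have h2 : ∀ M, blockMap φ ε ε M = blockRingHom φ ε M := fun _ => rfl
    have h3 : ∀ M, blockMap φ ε' ε' M = blockRingHom φ ε' M := fun _ => rfl
    rw [h2, h3, ← map_pow, ← map_pow,
      scalar_add_shift_pow θ (pow_eq_zero_of_le (le_max_left _ _) hr),
      scalar_add_shift_pow θ (pow_eq_zero_of_le (le_max_right _ _) hr'), ← h2, ← h3] at h1
    obtain ⟨B, rfl⟩ := exists_blockMap_eq φ ε ε' hφ h1
    refine ⟨B, ?_, rfl⟩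
    rw [← blockMap_mul, ← blockMap_mul] at h
    have h4 := blockMap_injective φ ε ε' h
    rw [Matrix.add_mul, Matrix.mul_add, hscalar] at h4
    exact add_left_cancel h4
  · rintro ⟨B, hB, rfl⟩
    rw [← blockMap_mul, ← blockMap_mul, Matrix.add_mul, Matrix.mul_add, hB, hscalar]

omit [Nonempty V] in
lemma isUnit_blockMap_scalar_add_shift (hθ : θ ≠ 0) :
    IsUnit (blockMap φ ε ε (Matrix.scalar _ θ + shift K len)) := by
  have := Fintype.ofFinite K
  obtain ⟨r, hr⟩ := isNilpotent_shift (K := K) (len := len)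
  refine IsUnit.map (blockRingHom φ ε) ((isUnit_pow_iff (n := Fintype.card K ^ r) ?_).1 ?_)
  · exact pow_ne_zero _ Fintype.card_ne_zero
  · rw [scalar_add_shift_pow θ hr]
    exact hθ.isUnit.map (Matrix.scalar (Boxes len))

variable {f : F[X]} {a : ℕ} (l : a.Partition)

/-- The lengths of the rows of the Young diagram of `l`. -/
abbrev rowLength (k : Fin (partList l).length) : ℕ := (partList l)[k]

/-- The position in `J_l(f)` as a box of the Young diagram of `l` and a position within a block of
order `d`. -/
def boxEquiv (d : ℕ) : Fin (d * a) ≃ Boxes (rowLength l) × Fin d :=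
  (jordanIndex l d).symm.trans
    (Equiv.sigmaProdDistrib (fun k => Fin (rowLength l k)) (Fin d)).symm

lemma boxEquiv_jordanIndex (d : ℕ) (k : Fin (partList l).length) (x : Fin (partList l)[k])
    (u : Fin d) : boxEquiv l d (jordanIndex l d ⟨k, (x, u)⟩) = (⟨k, x⟩, u) := by
  rw [boxEquiv, Equiv.trans_apply, Equiv.symm_apply_apply]
  rfl

omit [Finite K] in
lemma jordanMatrix_eq_blockMap (φ : K →ₐ[F] Matrix (Fin f.natDegree) (Fin f.natDegree) F)
    (hθ : φ θ = companion f) :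
    jordanMatrix f l = blockMap φ (boxEquiv l f.natDegree) (boxEquiv l f.natDegree)
      (Matrix.scalar _ θ + shift K (rowLength l)) := by
  ext i j
  obtain ⟨⟨k, x, u⟩, rfl⟩ := (jordanIndex l f.natDegree).surjective i
  obtain ⟨⟨k', y, v⟩, rfl⟩ := (jordanIndex l f.natDegree).surjective j
  simp only [jordanMatrix, Matrix.reindex_apply, Matrix.submatrix_apply, Equiv.symm_apply_apply,
    blockMap, Matrix.of_apply, boxEquiv_jordanIndex]
  by_cases hk : k = k'
  · subst hk
    rw [Matrix.blockDiagonal'_apply_eq, Matrix.add_apply, Matrix.scalar_apply]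
    by_cases hxy : x = y
    · subst hxy
      simp [jordanBlock, shift, hθ]
    · by_cases hxy' : x.val + 1 = y.val
      · simp [jordanBlock, shift, hxy, hxy']
      · simp [jordanBlock, shift, hxy, hxy']
  · rw [Matrix.blockDiagonal'_apply_ne _ _ _ hk]
    simp [shift, hk]

end Jordan
/-! ### Free entries of an intertwiner -/

section FreeEntries

variable {K : Type*} [Field K] {κ κ' : Type*} [Fintype κ] [DecidableEq κ] [Fintype κ']
  [DecidableEq κ'] {len : κ → ℕ} {len' : κ' → ℕ}

/-- The positions `(k, l, y)` of the coefficients of `t^y` in the maps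
`K[t]/t^(len k) → K[t]/t^(len' l)` that may be nonzero, without the constant terms of the maps
between summands of the same length. -/
abbrev FreeEntry (len : κ → ℕ) (len' : κ' → ℕ) : Type _ :=
  {t : (_ : κ) × (l : κ') × Fin (len' l) //
    len' t.2.1 ≤ t.2.2.val + len t.1 ∧ ¬ (len t.1 = len' t.2.1 ∧ t.2.2.val = 0)}

/-- The value of `B` at a free entry. -/
def freePart (hlen : ∀ k, 0 < len k) (B : Matrix (Boxes len) (Boxes len') K)
    (t : FreeEntry len len') : K :=
  B ⟨t.1.1, ⟨0, hlen _⟩⟩ t.1.2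

variable {ρ ρ' : ℕ → Type*} (hlen : ∀ k, 0 < len k) (hlen' : ∀ k, 0 < len' k)
  (e : ∀ s, ρ s ≃ {k // len k = s}) (e' : ∀ s, ρ' s ≃ {k // len' k = s})
  {N : ℕ} (hN : ∀ k, len k ≤ N)

include hN in
lemma ext_of_freePart {B B' : Matrix (Boxes len) (Boxes len') K}
    (hB : shift K len * B = B * shift K len') (hB' : shift K len * B' = B' * shift K len')
    (h : freePart hlen B = freePart hlen B')
    (h' : ∀ s ∈ Finset.Icc 1 N, B.submatrix (firstBox hlen (e s)) (firstBox hlen' (e' s)) =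
      B'.submatrix (firstBox hlen (e s)) (firstBox hlen' (e' s))) : B = B' := by
  refine ext_of_apply_zero hB hlen hB' fun k l y hy => ?_
  by_cases hkl : len k = len' l ∧ y.val = 0
  · obtain ⟨hkl, hy0⟩ := hkl
    obtain rfl : y = ⟨0, hlen' l⟩ := Fin.ext hy0
    have h1 := congrFun (congrFun (h' (len k) (Finset.mem_Icc.2 ⟨hlen k, hN k⟩))
      ((e _).symm ⟨k, rfl⟩)) ((e' _).symm ⟨l, hkl.symm⟩)
    simpa only [Matrix.submatrix_apply, firstBox_symm_apply] using h1
  · exact congrFun h ⟨⟨k, l, y⟩, hy, hkl⟩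

include hN in
/-- The free entries and the constant terms between summands of the same length can be prescribed
arbitrarily. -/
lemma exists_intertwiner (a : FreeEntry len len' → K)
    (T : ∀ s : Finset.Icc 1 N, Matrix (ρ s) (ρ' s) K) :
    ∃ B : Matrix (Boxes len) (Boxes len') K, shift K len * B = B * shift K len' ∧
      freePart hlen B = a ∧
      ∀ s : Finset.Icc 1 N,
        B.submatrix (firstBox hlen (e s)) (firstBox hlen' (e' s)) = T s := by
  let b : κ → κ' → ℕ → K := fun k l y =>
    if h : len k = len' l ∧ y = 0 then
      T ⟨len k, Finset.mem_Icc.2 ⟨hlen k, hN k⟩⟩ ((e _).symm ⟨k, rfl⟩) ((e' _).symm ⟨l, h.1.symm⟩)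
    else if h' : y < len' l ∧ len' l ≤ y + len k then a ⟨⟨k, l, ⟨y, h'.1⟩⟩, h'.2, h⟩
    else 0
  have hb : ∀ k l (y : Fin (len' l)),
      toeplitz len len' b ⟨k, ⟨0, hlen k⟩⟩ ⟨l, y⟩ = b k l y := fun k l y => by simp [toeplitz]
  refine ⟨toeplitz len len' b, shift_mul_toeplitz b fun k l y hy hne => ?_, ?_, ?_⟩
  · by_contra hlt
    refine hne ?_
    simp only [b]
    rw [dif_neg (by rintro ⟨h1, rfl⟩; omega), dif_neg (fun h => hlt h.2)]
  · ext ⟨⟨k, l, y⟩, hy, hkl⟩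
    refine (hb k l y).trans ?_
    simp only [b]
    rw [dif_neg hkl, dif_pos ⟨y.2, hy⟩]
  · rintro ⟨s, hs⟩
    ext p q
    obtain ⟨⟨k, hk⟩, rfl⟩ := (e s).symm.surjective p
    obtain ⟨⟨l, hl⟩, rfl⟩ := (e' s).symm.surjective q
    subst hk
    rw [Matrix.submatrix_apply, firstBox_symm_apply, firstBox_symm_apply, hb]
    simp only [b]
    rw [dif_pos ⟨hl.symm, trivial⟩]

lemma card_filter_le_add {a x y : ℕ} (hx : x ≤ a) :
    (Finset.univ.filter fun t : Fin y => y ≤ t + x).card =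
      ((Finset.Icc 1 a).filter fun i => i ≤ x ∧ i ≤ y).card := by
  refine Finset.card_bij' (fun t _ => y - t.val) (fun i hi => ⟨y - i, ?_⟩) ?_ ?_ ?_ ?_
  · simp only [Finset.mem_filter, Finset.mem_Icc] at hi
    omega
  · intro t ht
    simp only [Finset.mem_filter, Finset.mem_Icc, Finset.mem_univ, true_and] at ht ⊢
    omega
  · intro i hi
    simp only [Finset.mem_filter, Finset.mem_Icc, Finset.mem_univ, true_and] at hi ⊢
    omega
  · intro t ht
    ext
    simp only
    omega
  · intro i hi
    simp only [Finset.mem_filter, Finset.mem_Icc] at hi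
    simp only
    omega

include hlen' in
lemma card_freeEntry {a : ℕ} (ha : ∀ k, len k ≤ a) :
    Nat.card (FreeEntry len len') =
      ∑ i ∈ Finset.Icc 1 a, (Finset.univ.filter fun k => i ≤ len k).card *
          (Finset.univ.filter fun l => i ≤ len' l).card -
      ∑ s ∈ Finset.Icc 1 a, (Finset.univ.filter fun k => len k = s).card *
          (Finset.univ.filter fun l => len' l = s).card := by
  rw [Nat.card_eq_fintype_card, Fintype.card_subtype, Finset.filter_and_not,
    Finset.card_sdiff_of_subset]
  · congr 1
    · simp_rw [Finset.card_filter _ Finset.univ, Fintype.sum_sigma, Finset.sum_mul_sum]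
      symm
      refine Finset.sum_comm.trans (Finset.sum_congr rfl fun k _ =>
        Finset.sum_comm.trans (Finset.sum_congr rfl fun l _ => ?_))
      symm
      rw [← Finset.card_filter, card_filter_le_add (ha k), Finset.card_filter]
      refine Finset.sum_congr rfl fun i _ => ?_
      rw [ite_and]
      split_ifs <;> rfl
    · simp_rw [Finset.card_filter _ Finset.univ, Fintype.sum_sigma, Finset.sum_mul_sum]
      symm
      refine Finset.sum_comm.trans (Finset.sum_congr rfl fun k _ =>
        Finset.sum_comm.trans (Finset.sum_congr rfl fun l _ => ?_))
      symm
      rw [Finset.sum_eq_single ⟨0, hlen' l⟩, Finset.sum_eq_single (len' l)]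
      · by_cases h : len k = len' l <;> simp [h]
      · intro s _ hs
        rw [if_neg (fun h : len' l = s => hs h.symm), mul_zero]
      · intro h
        by_cases hk : len k = len' l
        · exact absurd (Finset.mem_Icc.2 ⟨hlen' l, hk ▸ ha k⟩) h
        · simp [hk]
      · intro y _ hy
        rw [if_neg]
        exact fun h => hy (Fin.ext h.2)
      · simp
  · intro t ht
    simp only [Finset.mem_filter, Finset.mem_univ, true_and] at ht ⊢
    omega

end FreeEntries

/-! ### Young diagrams of partitions -/

section RowLength

variable {a b : ℕ} (l : a.Partition)

lemma map_rowLength : Finset.univ.val.map (rowLength l) = l.parts := by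
  have h : List.ofFn (rowLength l) = partList l := List.ofFn_getElem
  rw [Fin.univ_val_map, h, partList, Multiset.sort_eq]

lemma rowLength_mem (k : Fin (partList l).length) : rowLength l k ∈ l.parts := by
  rw [← map_rowLength l]
  exact Multiset.mem_map_of_mem _ (Finset.mem_univ k)

lemma rowLength_pos (k : Fin (partList l).length) : 0 < rowLength l k :=
  l.parts_pos (rowLength_mem l k)

lemma rowLength_le (k : Fin (partList l).length) : rowLength l k ≤ a :=
  (Multiset.le_sum_of_mem (rowLength_mem l k)).trans_eq l.parts_sum

lemma card_filter_rowLength_eq (s : ℕ) :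
    (Finset.univ.filter fun k => rowLength l k = s).card = mult l s := by
  rw [mult, ← map_rowLength l, Multiset.count_map, Finset.card_def, Finset.filter_val]
  simp_rw [eq_comm]

lemma card_filter_le_rowLength (i : ℕ) :
    (Finset.univ.filter fun k => i ≤ rowLength l k).card = conjPart l i := by
  rw [conjPart, ← map_rowLength l, Multiset.filter_map, Multiset.card_map]
  rfl

lemma card_freeEntry_rowLength (m : b.Partition) :
    Nat.card (FreeEntry (rowLength l) (rowLength m)) = redInnerProd l m := by
  rw [card_freeEntry (rowLength_pos m) (rowLength_le l)]
  simp_rw [card_filter_le_rowLength, card_filter_rowLength_eq]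
  rfl

/-- A numbering of the rows of length `s` of the Young diagram of `l`. -/
noncomputable def rowEquiv (s : ℕ) : Fin (mult l s) ≃ {k // rowLength l k = s} :=
  (Fintype.equivFinOfCardEq
    ((Fintype.card_subtype _).trans (card_filter_rowLength_eq l s))).symm

end RowLength

/-! ### Evaluation of relations -/

namespace RepOn

variable {n : ℕ} {C : Matrix (Fin n) (Fin n) ℕ} {F K : Type*} [Field F] [Field K] [Algebra F K]

section BlockMap

variable {V : Type*} [Fintype V] [DecidableEq V] (φ : K →ₐ[F] Matrix V V F)
  {ι P : Fin n → Type*} [∀ i, Fintype (ι i)] [∀ i, Fintype (P i)] (ε : ∀ i, ι i ≃ P i × V)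

/-- Restriction of scalars for representations. -/
def restrict (τ : RepOn C P K) : RepOn C ι F :=
  fun i j c => blockMap φ (ε i) (ε j) (τ i j c)

omit [∀ i, Fintype (ι i)] [∀ i, Fintype (P i)] in
lemma restrict_injective [Nonempty V] :
    Function.Injective (restrict φ ε : RepOn C P K → RepOn C ι F) := by
  intro τ τ' h
  funext i j c
  exact blockMap_injective φ _ _ (congrFun (congrFun (congrFun h i) j) c)

lemma evalSimple_restrict (τ : RepOn C P K) {i j : Fin n} (p : SimpleRelation C i j) :
    (τ.restrict φ ε).evalSimple p = blockMap φ (ε i) (ε j) (τ.evalSimple p) := by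
  induction p with
  | arrow k => rfl
  | mul p k ih =>
    simp only [evalSimple]
    rw [ih, blockMap_mul φ _ (ε _)]
    rfl

lemma eval_restrict (τ : RepOn C P K) (R : CyclicRelation C F) :
    (τ.restrict φ ε).eval R = blockMap φ (ε _) (ε _) (τ.eval R) := by
  ext a b
  simp [eval, Finsupp.sum, evalSimple_restrict, blockMap, Matrix.sum_apply]

variable [∀ i, DecidableEq (ι i)] [∀ i, DecidableEq (P i)]

lemma respectsNilpotently_restrict [Nonempty V] (τ : RepOn C P K)
    (𝓡 : Set (CyclicRelation C F)) :
    (τ.restrict φ ε).RespectsNilpotently 𝓡 ↔ τ.RespectsNilpotently 𝓡 := by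
  refine forall₂_congr fun R _ => ?_
  rw [eval_restrict, isNilpotent_blockMap]

end BlockMap

section Intertwiners

variable {κ : Fin n → Type*} [∀ i, Fintype (κ i)] [∀ i, DecidableEq (κ i)]
  {len : ∀ i, κ i → ℕ}

/-- `τ` is a representation in `K[t]`-modules `⨁ₖ K[t]/t^(len i k)`. -/
def CommutesWithShift (τ : RepOn C (fun i => Boxes (len i)) K) : Prop :=
  ∀ i j c, shift K (len i) * τ i j c = τ i j c * shift K (len j)

variable {τ : RepOn C (fun i => Boxes (len i)) K}

lemma CommutesWithShift.evalSimple (hτ : τ.CommutesWithShift) {i j : Fin n}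
    (p : SimpleRelation C i j) :
    shift K (len i) * τ.evalSimple p = τ.evalSimple p * shift K (len j) := by
  induction p with
  | arrow k => exact hτ _ _ k
  | mul p k ih =>
    simp only [RepOn.evalSimple]
    rw [← Matrix.mul_assoc, ih, Matrix.mul_assoc, hτ, Matrix.mul_assoc]

lemma CommutesWithShift.eval (hτ : τ.CommutesWithShift) (R : CyclicRelation C F) :
    Commute (shift K (len R.vertex)) (τ.eval R) :=
  Commute.sum_right _ _ _ fun p _ => Commute.smul_right (hτ.evalSimple p) _

variable (hlen : ∀ i k, 0 < len i k) {s : ℕ} {m : Fin n → ℕ}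
  (e : ∀ i, Fin (m i) ≃ {k // len i k = s})

/-- The representation on the rows of length `s` that is given by the constant terms. -/
def constantPart (τ : RepOn C (fun i => Boxes (len i)) K) : Rep C m K :=
  fun i j c => (τ i j c).submatrix (firstBox (hlen i) (e i)) (firstBox (hlen j) (e j))

lemma evalSimple_constantPart (hτ : τ.CommutesWithShift) {i j : Fin n}
    (p : SimpleRelation C i j) :
    (constantPart hlen e τ).evalSimple p =
      (τ.evalSimple p).submatrix (firstBox (hlen i) (e i)) (firstBox (hlen j) (e j)) := by
  induction p with
  | arrow k => rfl
  | mul p k ih =>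
    simp only [RepOn.evalSimple]
    rw [ih, submatrix_firstBox_mul (hlen _) (hlen _) (hlen _) (e _) (e _) (e _)
      (hτ.evalSimple p) (hτ _ _ k)]
    rfl

lemma eval_constantPart (hτ : τ.CommutesWithShift) (R : CyclicRelation C F) :
    (constantPart hlen e τ).eval R =
      (τ.eval R).submatrix (firstBox (hlen _) (e _)) (firstBox (hlen _) (e _)) := by
  ext a b
  simp [RepOn.eval, Finsupp.sum, evalSimple_constantPart hlen e hτ, Matrix.sum_apply]

end Intertwiners

section Count

variable {κ : Fin n → Type*} [∀ i, Fintype (κ i)] [∀ i, DecidableEq (κ i)]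
  {len : ∀ i, κ i → ℕ} (hlen : ∀ i k, 0 < len i k) {m : Fin n → ℕ → ℕ}
  (e : ∀ i s, Fin (m i s) ≃ {k // len i k = s}) {N : ℕ} (hN : ∀ i k, len i k ≤ N)

include hN in
lemma respectsNilpotently_iff_constantPart {τ : RepOn C (fun i => Boxes (len i)) K}
    (hτ : τ.CommutesWithShift) (𝓡 : Set (CyclicRelation C F)) :
    τ.RespectsNilpotently 𝓡 ↔ ∀ s : Finset.Icc 1 N,
      (constantPart hlen (fun i => e i s) τ).RespectsNilpotently 𝓡 := by
  have h1 : ∀ R : CyclicRelation C F, IsNilpotent (τ.eval R) ↔ ∀ s : Finset.Icc 1 N,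
      IsNilpotent ((constantPart hlen (fun i => e i s) τ).eval R) := by
    intro R
    rw [isNilpotent_iff_submatrix_firstBox (hlen _) (e _) (hN _) (hτ.eval R)]
    simp only [Subtype.forall, eval_constantPart hlen _ hτ]
  simp only [RespectsNilpotently, h1]
  exact ⟨fun h s R hR => h R hR s, fun h R hR s => h s R hR⟩

include hlen e hN in
/-- The nilpotency condition only sees the constant parts, and the free entries are arbitrary. -/
lemma ncard_commutesWithShift (𝓡 : Set (CyclicRelation C F)) :
    {τ : RepOn C (fun i => Boxes (len i)) K |
        τ.CommutesWithShift ∧ τ.RespectsNilpotently 𝓡}.ncard =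
      Nat.card K ^ (∑ i, ∑ j, C i j * Nat.card (FreeEntry (len i) (len j))) *
        ∏ s ∈ Finset.Icc 1 N, (nilRep 𝓡 (fun i => m i s) K).ncard := by
  let G : {τ : RepOn C (fun i => Boxes (len i)) K |
        τ.CommutesWithShift ∧ τ.RespectsNilpotently 𝓡} →
      (∀ i j, Fin (C i j) → FreeEntry (len i) (len j) → K) ×
        (∀ s : Finset.Icc 1 N, nilRep 𝓡 (fun i => m i s) K) :=
    fun τ => (fun i j c => freePart (hlen i) (τ.1 i j c), fun s =>
      ⟨constantPart hlen (fun i => e i s) τ.1,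
        (respectsNilpotently_iff_constantPart hlen e hN τ.2.1 𝓡).1 τ.2.2 s⟩)
  have hG : Function.Bijective G := by
    constructor
    · rintro ⟨τ, hτ, h⟩ ⟨τ', hτ', h'⟩ heq
      refine Subtype.ext ?_
      funext i j c
      refine ext_of_freePart (hlen i) (hlen j) (e i) (e j) (hN i) (hτ i j c) (hτ' i j c)
        (congrFun (congrFun (congrFun (congrArg Prod.fst heq) i) j) c) fun s hs => ?_
      exact congrFun (congrFun (congrFun
        (congrArg Subtype.val (congrFun (congrArg Prod.snd heq) ⟨s, hs⟩)) i) j) c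
    · rintro ⟨a, T⟩
      choose τ hτ ha hT using fun i j c => exists_intertwiner (hlen i) (hlen j) (e i) (e j)
        (hN i) (a i j c) fun s => (T s).1 i j c
      have hconst : ∀ s : Finset.Icc 1 N, constantPart hlen (fun i => e i s) τ = (T s).1 := by
        intro s
        funext i j c
        exact hT i j c s
      refine ⟨⟨τ, hτ, (respectsNilpotently_iff_constantPart hlen e hN hτ 𝓡).2 fun s => ?_⟩, ?_⟩
      · rw [hconst]
        exact (T s).2
      · refine Prod.ext ?_ ?_
        · funext i j c
          exact ha i j c
        · funext s
          exact Subtype.ext (hconst s)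
  rw [← Nat.card_coe_set_eq, Nat.card_eq_of_bijective G hG, Nat.card_prod]
  congr 1
  · simp only [Nat.card_pi, Finset.prod_const, Finset.card_univ, Fintype.card_fin, ← pow_mul,
      Finset.prod_pow_eq_pow_sum, Nat.card_eq_fintype_card (α := FreeEntry _ _), mul_comm]
  · rw [Nat.card_pi]
    exact Finset.prod_coe_sort (Finset.Icc 1 N) fun s => (nilRep 𝓡 (fun i => m i s) K).ncard

end Count

end RepOn

/-! ### Representations fixed by Jordan forms -/

section Main

variable {F : Type*} [Field F] [Finite F] {n : ℕ} {C : Matrix (Fin n) (Fin n) ℕ}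

lemma mem_fixedReps_iff {α : Fin n → ℕ} {K : Type*} [Field K] {g : ∀ i, GL (Fin (α i)) K}
    {σ : Rep C α K} :
    σ ∈ fixedReps C g ↔ ∀ i j c, (g i).val * σ i j c = σ i j c * (g j).val := by
  have h : ∀ i j c, σ.act g i j c = σ i j c ↔ (g i).val * σ i j c = σ i j c * (g j).val := by
    intro i j c
    have h1 : (g i).val * ((g i)⁻¹ : GL (Fin (α i)) K).val = 1 := Units.mul_inv _
    have h2 : ((g i)⁻¹ : GL (Fin (α i)) K).val * (g i).val = 1 := Units.inv_mul _
    constructor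
    · intro h
      calc (g i).val * σ i j c = (g i).val * σ.act g i j c := by rw [h]
        _ = σ i j c * (g j).val := by
          rw [RepOn.act, ← Matrix.mul_assoc, ← Matrix.mul_assoc, h1, Matrix.one_mul]
    · intro h
      rw [RepOn.act, Matrix.mul_assoc, ← h, ← Matrix.mul_assoc, h2, Matrix.one_mul]
  exact ⟨fun hσ i j c => (h i j c).1 (congrFun (congrFun (congrFun hσ i) j) c),
    fun hσ => by funext i j c; exact (h i j c).2 (hσ i j c)⟩

variable {f : F[X]} (hf : f.Monic) (hirr : Irreducible f) {w : Fin n → ℕ}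
  (π : ∀ i, (w i).Partition)

include hf hirr in
lemma isUnit_jordanMatrix (hX : f ≠ X) {a : ℕ} (l : a.Partition) : IsUnit (jordanMatrix f l) := by
  have : Fact (Irreducible f) := ⟨hirr⟩
  have hK : Module.finrank F (AdjoinRoot f) = f.natDegree :=
    (AdjoinRoot.powerBasis hf.ne_zero).finrank
  have hd : 0 < f.natDegree := hirr.natDegree_pos
  have : Module.Finite F (AdjoinRoot f) := Module.finite_of_finrank_pos (by omega)
  have : Finite (AdjoinRoot f) := Module.finite_of_finite F
  obtain ⟨φ, θ, hθ, hroot, -⟩ := exists_algHom_companion hf hirr hK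
  rw [jordanMatrix_eq_blockMap l φ hθ]
  exact isUnit_blockMap_scalar_add_shift φ _ (ne_zero_of_aeval_eq_zero hf hirr hX hroot)

include hf hirr in
lemma ncard_fixedReps_inter_nilRep (𝓡 : Set (CyclicRelation C F))
    {g : ∀ i, GL (Fin (f.natDegree * w i)) F} (hg : ∀ i, (g i).val = jordanMatrix f (π i))
    {K : Type*} [Field K] [Algebra F K] (hK : Module.finrank F K = f.natDegree)
    {N : ℕ} (hN : ∀ i, ∀ s ∈ (π i).parts, s ≤ N) :
    (fixedReps C g ∩ nilRep 𝓡 (fun i => f.natDegree * w i) F).ncard =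
      Nat.card F ^ (f.natDegree * ∑ i, ∑ j, C i j * redInnerProd (π i) (π j)) *
        ∏ s ∈ Finset.Icc 1 N, (nilRep 𝓡 (fun i => mult (π i) s) K).ncard := by
  have hd : 0 < f.natDegree := hirr.natDegree_pos
  have : Nonempty (Fin f.natDegree) := ⟨⟨0, hd⟩⟩
  have : Module.Finite F K := Module.finite_of_finrank_pos (by omega)
  have : Finite K := Module.finite_of_finite F
  obtain ⟨φ, θ, hθ, -, hφ⟩ := exists_algHom_companion hf hirr hK
  rw [← hθ] at hφ
  let ε := fun i => boxEquiv (π i) f.natDegree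
  have himage : fixedReps C g ∩ nilRep 𝓡 (fun i => f.natDegree * w i) F =
      RepOn.restrict φ ε '' {τ : RepOn C (fun i => Boxes (rowLength (π i))) K |
        τ.CommutesWithShift ∧ τ.RespectsNilpotently 𝓡} := by
    ext σ
    simp only [Set.mem_inter_iff, mem_fixedReps_iff, hg, jordanMatrix_eq_blockMap _ φ hθ,
      blockMap_mul_eq_mul_blockMap_iff φ _ _ hφ]
    constructor
    · rintro ⟨h1, h2⟩
      choose τ hτ hσ using h1
      obtain rfl : RepOn.restrict φ ε τ = σ := by
        funext i j c
        exact hσ i j c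
      exact ⟨τ, ⟨hτ, (RepOn.respectsNilpotently_restrict φ ε τ 𝓡).1 h2⟩, rfl⟩
    · rintro ⟨τ, ⟨hτ, h2⟩, rfl⟩
      exact ⟨fun i j c => ⟨τ i j c, hτ i j c, rfl⟩,
        (RepOn.respectsNilpotently_restrict φ ε τ 𝓡).2 h2⟩
  rw [himage, Set.ncard_image_of_injective _ (RepOn.restrict_injective φ ε),
    RepOn.ncard_commutesWithShift (fun i => rowLength_pos (π i)) (fun i => rowEquiv (π i))
      (fun i k => hN i _ (rowLength_mem (π i) k)),
    Module.natCard_eq_pow_finrank (K := F) (V := K), hK, ← pow_mul]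
  simp_rw [card_freeEntry_rowLength]

end Main
end NilpQuiver

theorem theorem2p7 {F : Type*} [Field F] [Finite F]
    {n : ℕ} (C : Matrix (Fin n) (Fin n) ℕ) (𝓡 : Set (NilpQuiver.CyclicRelation C F))
    (f : F[X]) (hf : f.Monic) (hirr : Irreducible f) (hX : f ≠ X)
    (w : Fin n → ℕ) (π : ∀ i, (w i).Partition) :
    ∃ g : ∀ i, GL (Fin (f.natDegree * w i)) F,
      (∀ i, (g i).val = NilpQuiver.jordanMatrix f (π i)) ∧
      (∀ (K : Type*) [Field K] [Algebra F K], Module.finrank F K = f.natDegree →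
        ∀ N : ℕ, (∀ i, ∀ s ∈ (π i).parts, s ≤ N) →
          (NilpQuiver.fixedReps C g ∩
              NilpQuiver.nilRep 𝓡 (fun i => f.natDegree * w i) F).ncard =
            Nat.card F ^
                (f.natDegree * ∑ i, ∑ j, C i j * NilpQuiver.redInnerProd (π i) (π j)) *
              ∏ s ∈ Finset.Icc 1 N,
                (NilpQuiver.nilRep 𝓡 (fun i => NilpQuiver.mult (π i) s) K).ncard) ∧
      (∀ r : (Fin n → ℕ) → ℚ[X], (∀ α, NilpQuiver.IsCountingPolynomial 𝓡 α (r α)) →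
        ∀ N : ℕ, (∀ i, ∀ s ∈ (π i).parts, s ≤ N) →
          ((NilpQuiver.fixedReps C g ∩
              NilpQuiver.nilRep 𝓡 (fun i => f.natDegree * w i) F).ncard : ℚ) =
            (Nat.card F : ℚ) ^
                (f.natDegree * ∑ i, ∑ j, C i j * NilpQuiver.redInnerProd (π i) (π j)) *
              ∏ s ∈ Finset.Icc 1 N,
                (r fun i => NilpQuiver.mult (π i) s).eval
                  ((Nat.card F : ℚ) ^ f.natDegree)) := by
  refine ⟨fun i => (NilpQuiver.isUnit_jordanMatrix hf hirr hX (π i)).unit, fun i => rfl, ?_, ?_⟩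
  · intro K _ _ hK N hN
    exact NilpQuiver.ncard_fixedReps_inter_nilRep hf hirr π 𝓡 (fun i => rfl) hK hN
  · intro r hr N hN
    have : Fact (Irreducible f) := ⟨hirr⟩
    have hK : Module.finrank F (AdjoinRoot f) = f.natDegree :=
      (AdjoinRoot.powerBasis hf.ne_zero).finrank
    rw [NilpQuiver.ncard_fixedReps_inter_nilRep hf hirr π 𝓡 (fun i => rfl) hK hN]
    push_cast
    congr 1
    exact Finset.prod_congr rfl fun s _ => hr _ _ hirr.natDegree_pos (AdjoinRoot f) hK
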